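/- Let $\mu^\pm$ be Borel probability measures on $\mathbb{R}^d$ with compact support, and let $\Pi(\mu^-,\mu^+)$ be the set of probability measures on $\mathbb{R}^d\times\mathbb{R}^d$ with marginals $\mu^-$ and $\mu^+$. For $\varepsilon>0$ let $\gamma_\varepsilon$ denote the optimal entropic plan for the quadratic cost, i.e. the minimizer over $\gamma\in\Pi(\mu^-,\mu^+)$ of $$\int \tfrac12|x-y|^2\,d\gamma(x,y)+\varepsilon\,\mathrm{Ent}(\gamma\,|\,\mu^-\otimes\mu^+),$$ where $\mathrm{Ent}(\gamma\,|\,q)=\int\rho\log\rho\,dq$ if $\gamma=\rho q$, and $+\infty$ otherwise. Let $f:\mathbb{R}^d\to\mathbb{R}\cup\{+\infty\}$ be a Brenier potential from $\mu^-$ to $\mu^+$, i.e. a proper lower semicontinuous convex function such that a coupling $\gamma\in\Pi(\mu^-,\mu^+)$ minimizes $\int\frac12|x-y|^2\,d\gamma$ over $\Pi(\mu^-,\mu^+)$ if and only if $$\operatorname{spt}\gamma\subseteq\Gamma_f:=\{(x,y): f(x)+f^*(y)=x\cdot y\},\qquad f^*(y)=\sup_x\,(x\cdot y-f(x)).$$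 Let $\partial f(x)=\{y:\ f(z)\ge f(x)+y\cdot(z-x)\ \text{for all } z\}$ (for $f(x)<+\infty$, and $\partial f(x)=\emptyset$ otherwise) be its subdifferential. Then the resolvent $(\mathrm{id}+\partial f)^{-1}$ is single-valued and defined everywhere: for each $z\in\mathbb{R}^d$ there is exactly one $p=:(\mathrm{id}+\partial f)^{-1}(z)$ with $z-p\in\partial f(p)$. Moreover there is a constant $C$, depending only on $d$ and $\mu^\pm$, such that for every $\varepsilon\in(0,1)$ the function $(x,y)\mapsto|x-(\mathrm{id}+\partial f)^{-1}(x+y)|^2$ is $\gamma_\varepsilon$-integrable and $$\int_{\mathbb{R}^d\times\mathbb{R}^d}\bigl|x-(\mathrm{id}+\partial f)^{-1}(x+y)\bigr|^2\,d\gamma_\varepsilon(x,y)\ \le\ d\,\varepsilon\log(1/\varepsilon)+C\varepsilon .$$ -/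

import Mathlib

open MeasureTheory Set
open scoped ENNReal

noncomputable section

namespace EntropicOT

variable {d : ℕ}

/-- `ℝ^d` with its Euclidean structure. -/
abbrev Space (d : ℕ) : Type := EuclideanSpace ℝ (Fin d)

/-- `γ ∈ Π(μ, ν)`: the marginals of `γ` are `μ` and `ν`. -/
def IsCoupling (μ ν : Measure (Space d)) (γ : Measure (Space d × Space d)) : Prop :=
  γ.fst = μ ∧ γ.snd = ν

/-- The quadratic transport cost `∫ ½ |x - y|² dγ(x, y)`. -/
def transportCost (γ : Measure (Space d × Space d)) : ℝ≥0∞ :=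
  ∫⁻ p, ENNReal.ofReal (1 / 2 * ‖p.1 - p.2‖ ^ 2) ∂γ

/-- The entropic transport cost `∫ ½ |x - y|² dγ(x, y) + ε Ent(γ | μ ⊗ ν)`. -/
def entropicCost (ε : ℝ) (μ ν : Measure (Space d)) (γ : Measure (Space d × Space d)) : ℝ≥0∞ :=
  transportCost γ + ENNReal.ofReal ε * InformationTheory.klDiv γ (μ.prod ν)

/-- `γ` minimises the quadratic transport cost over `Π(μ, ν)`. -/
def IsOptimalPlan (μ ν : Measure (Space d)) (γ : Measure (Space d × Space d)) : Prop :=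
  IsCoupling μ ν γ ∧ ∀ γ', IsCoupling μ ν γ' → transportCost γ ≤ transportCost γ'

/-- `γ` minimises the entropic transport cost with parameter `ε` over `Π(μ, ν)`. -/
def IsOptimalEntropicPlan (ε : ℝ) (μ ν : Measure (Space d))
    (γ : Measure (Space d × Space d)) : Prop :=
  IsCoupling μ ν γ ∧ ∀ γ', IsCoupling μ ν γ' → entropicCost ε μ ν γ ≤ entropicCost ε μ ν γ'

/-- Proper, lower semicontinuous, convex functions `ℝ^d → ℝ ∪ {+∞}`;
convexity is convexity of the epigraph. -/
structure IsProperLscConvex (f : Space d → EReal) : Prop where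
  ne_bot : ∀ x, f x ≠ ⊥
  exists_ne_top : ∃ x, f x ≠ ⊤
  convex_epigraph : Convex ℝ {p : Space d × ℝ | f p.1 ≤ (p.2 : EReal)}
  lsc : LowerSemicontinuous f

/-- The Legendre transform `f^*(y) = sup_x (x ⬝ y - f(x))`. -/
def conjugate (f : Space d → EReal) (y : Space d) : EReal :=
  ⨆ x, ((inner ℝ x y : ℝ) : EReal) - f x

/-- `Γ_f = {(x, y) : f(x) + f^*(y) = x ⬝ y}`. -/
def contactSet (f : Space d → EReal) : Set (Space d × Space d) :=
  {p | f p.1 + conjugate f p.2 = ((inner ℝ p.1 p.2 : ℝ) : EReal)}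

/-- The subdifferential `∂f(x)` of a proper convex function
(it is empty where `f x = ⊤`, since `f` is finite somewhere). -/
def subdifferential (f : Space d → EReal) (x : Space d) : Set (Space d) :=
  {y | ∀ z, f x + ((inner ℝ y (z - x) : ℝ) : EReal) ≤ f z}

/-- `f` is a Brenier potential from `μ` to `ν`: a (proper) lower semicontinuous convex function
such that a coupling of `μ` and `ν` is optimal for the quadratic cost if and only if
its support is contained in `Γ_f`. -/
structure IsBrenierPotential (μ ν : Measure (Space d)) (f : Space d → EReal) : Prop where
  properLscConvex : IsProperLscConvex f
  optimal_iff : ∀ γ, IsCoupling μ ν γ → (IsOptimalPlan μ ν γ ↔ γ.support ⊆ contactSet f)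

/-- The set-valued map `(id + ∂f)⁻¹`: the set of all `p` with `z ∈ p + ∂f(p)`. -/
def subdiffResolventSet (f : Space d → EReal) (z : Space d) : Set (Space d) :=
  {p | z - p ∈ subdifferential f p}

/-- The resolvent `(id + ∂f)⁻¹` as a map: an element of `subdiffResolventSet f z` (if there is one). -/
def subdiffResolvent (f : Space d → EReal) (z : Space d) : Space d :=
  Classical.epsilon fun p => p ∈ subdiffResolventSet f z

end EntropicOT

end

/-! Minty's trick: with p = (id + ∂f)⁻¹(x + y), the subgradient inequality at p and Fenchel's
inequality bound |x - p|² by the duality gap f(x) + f*(y) - x ⬝ y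
(`IsProperLscConvex.norm_sub_subdiffResolvent_sq_le`). The integral of f(x) + f*(y) is the same for
all couplings, and the gap vanishes almost everywhere for an optimal plan γ₀. Hence the gap
integrated over γ is ∫ x ⬝ y dγ₀ - ∫ x ⬝ y dγ, the excess transport cost of γ
(`integral_norm_sub_subdiffResolvent_sq_le`).

For an optimal entropic plan, minimality and nonnegativity of the entropy bound this excess by that
of any competitor plus ε times the competitor's entropy. The competitor cuts the second factor into
cubes of side ε and resamples y from ν within its cube (`blockPlan`). Moving y by at most √d ε costs
O(ε), and the entropy is at most the logarithm of the number of cubes, d log(1/ε) + O(1)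
(`IsCoupling.exists_low_entropy`). -/

namespace EntropicOT

/-! ### Convex analysis: the resolvent and the conjugate. -/

variable {d : ℕ} {f : Space d → EReal}

theorem IsProperLscConvex.le_combo (hf : IsProperLscConvex f) {x y : Space d} {a b s t : ℝ}
    (hx : f x ≤ a) (hy : f y ≤ b) (hs : 0 ≤ s) (ht : 0 ≤ t) (hst : s + t = 1) :
    f (s • x + t • y) ≤ ((s * a + t * b : ℝ) : EReal) :=
  hf.convex_epigraph (x := (x, a)) hx (y := (y, b)) hy hs ht hst

/-- A lower semicontinuous function without the value `-∞` is bounded below on compact sets. -/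
theorem exists_real_le_of_isCompact {f : Space d → EReal} (hlsc : LowerSemicontinuous f)
    (hbot : ∀ x, f x ≠ ⊥) {K : Set (Space d)} (hK : IsCompact K) :
    ∃ m : ℝ, ∀ x ∈ K, (m : EReal) ≤ f x := by
  rcases K.eq_empty_or_nonempty with rfl | hne
  · exact ⟨0, by simp⟩
  obtain ⟨u, -, hu⟩ := (hlsc.lowerSemicontinuousOn K).exists_isMinOn hne hK
  by_cases htop : f u = ⊤
  · exact ⟨0, fun x hx => by rw [top_le_iff.mp (htop ▸ hu hx : (⊤ : EReal) ≤ f x)]; exact le_top⟩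
  · exact ⟨(f u).toReal, fun x hx => by rw [EReal.coe_toReal htop (hbot u)]; exact hu hx⟩

theorem IsProperLscConvex.exists_eq_coe (hf : IsProperLscConvex f) :
    ∃ x, ∃ a : ℝ, f x = a := by
  obtain ⟨x, hx⟩ := hf.exists_ne_top
  exact ⟨x, (f x).toReal, (EReal.coe_toReal hx (hf.ne_bot x)).symm⟩

/-- The proximal functional `f + ½ |· - z|²` has a minimiser. -/
theorem IsProperLscConvex.exists_prox (hf : IsProperLscConvex f) (z : Space d) :
    ∃ p, ∃ a : ℝ, f p = a ∧ ∀ x (b : ℝ), f x ≤ b →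
      a + 1 / 2 * ‖p - z‖ ^ 2 ≤ b + 1 / 2 * ‖x - z‖ ^ 2 := by
  obtain ⟨x₀, b₀, hx₀⟩ := hf.exists_eq_coe
  obtain ⟨m, hm⟩ := exists_real_le_of_isCompact hf.lsc hf.ne_bot (isCompact_closedBall x₀ 1)
  set D := ‖x₀ - z‖
  -- At distance r > 1 from x₀, convexity and the bound m on the unit ball give f ≥ b₀ - r(b₀ - m).
  -- The quadratic term is at least (r - D)²/2, so beyond this R the functional exceeds its value b₀
  -- + D²/2 at x₀.
  set R := max 1 (2 * (D + b₀ - m)) with hR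
  let g : Space d → EReal := fun x => f x + ((1 / 2 * ‖x - z‖ ^ 2 : ℝ) : EReal)
  have hg : LowerSemicontinuous g := by
    refine hf.lsc.add' ?_ ?_
    · exact (continuous_coe_real_ereal.comp (by fun_prop)).lowerSemicontinuous
    · intro x
      exact EReal.continuousAt_add (Or.inr (EReal.coe_ne_bot _)) (Or.inr (EReal.coe_ne_top _))
  have hmem : x₀ ∈ Metric.closedBall x₀ R :=
    Metric.mem_closedBall_self (zero_le_one.trans (le_max_left _ _))
  obtain ⟨p, -, hmin⟩ := (hg.lowerSemicontinuousOn _).exists_isMinOn ⟨x₀, hmem⟩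
    (isCompact_closedBall x₀ R)
  have hgx : ∀ x ∈ Metric.closedBall x₀ R, g p ≤ g x := fun x hx => hmin hx
  have hp : f p ≠ ⊤ := by
    intro h
    have h0 := hgx x₀ hmem
    simp only [g, h, hx₀, EReal.top_add_coe, top_le_iff, ← EReal.coe_add] at h0
    exact EReal.coe_ne_top _ h0
  obtain ⟨a, ha⟩ : ∃ a : ℝ, f p = a := ⟨_, (EReal.coe_toReal hp (hf.ne_bot p)).symm⟩
  have key : ∀ x ∈ Metric.closedBall x₀ R, ∀ b : ℝ, f x ≤ b →
      a + 1 / 2 * ‖p - z‖ ^ 2 ≤ b + 1 / 2 * ‖x - z‖ ^ 2 := by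
    intro x hx b hb
    have h1 := (hgx x hx).trans (add_le_add_left hb _)
    simp only [g, ha] at h1
    exact_mod_cast h1
  refine ⟨p, a, ha, fun x b hb => ?_⟩
  by_cases hx : x ∈ Metric.closedBall x₀ R
  · exact key x hx b hb
  have h0 := key x₀ hmem b₀ hx₀.le
  rw [Metric.mem_closedBall, not_le, dist_eq_norm] at hx
  set r := ‖x - x₀‖ with hr
  have hr1 : 1 < r := (le_max_left _ _).trans_lt hx
  have hr2 : 2 * (D + b₀ - m) < r := (le_max_right _ _).trans_lt hx
  have hrpos : 0 < r := by linarith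
  have hinv : r⁻¹ ≤ 1 := inv_le_one_of_one_le₀ hr1.le
  have hc := hf.le_combo hx₀.le hb (s := 1 - r⁻¹) (t := r⁻¹) (by linarith) (by positivity) (by ring)
  have hball : (1 - r⁻¹) • x₀ + r⁻¹ • x ∈ Metric.closedBall x₀ 1 := by
    have : (1 - r⁻¹) • x₀ + r⁻¹ • x - x₀ = r⁻¹ • (x - x₀) := by module
    rw [Metric.mem_closedBall, dist_eq_norm, this, norm_smul, norm_inv, Real.norm_eq_abs,
      abs_of_pos hrpos, ← hr, inv_mul_cancel₀ hrpos.ne']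
  have hmb : m ≤ (1 - r⁻¹) * b₀ + r⁻¹ * b := by exact_mod_cast (hm _ hball).trans hc
  have hmb' : r * m ≤ (r - 1) * b₀ + b := by
    have := mul_le_mul_of_nonneg_left hmb hrpos.le
    have e : r * ((1 - r⁻¹) * b₀ + r⁻¹ * b) = (r - 1) * b₀ + b := by field_simp
    linarith
  have htri : r ≤ ‖x - z‖ + D := by
    have : x - x₀ = (x - z) - (x₀ - z) := by abel
    rw [hr, this]; exact norm_sub_le _ _
  have hD : 0 ≤ D := norm_nonneg _
  have hb0 : m ≤ b₀ := by
    exact_mod_cast (hm x₀ (Metric.mem_closedBall_self zero_le_one)).trans hx₀.le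
  have hrD : 0 ≤ r - D := by linarith
  have hsq : (r - D) ^ 2 ≤ ‖x - z‖ ^ 2 := by gcongr; linarith
  nlinarith [mul_pos hrpos (sub_pos.2 hr2)]

theorem eq_coe_of_mem_subdifferential (hf : IsProperLscConvex f) {p q : Space d}
    (h : q ∈ subdifferential f p) : ∃ a : ℝ, f p = a := by
  obtain ⟨x, b, hx⟩ := hf.exists_eq_coe
  refine ⟨(f p).toReal, (EReal.coe_toReal (fun hp => ?_) (hf.ne_bot p)).symm⟩
  have := h x
  rw [hp, hx, EReal.top_add_coe, top_le_iff] at this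
  exact EReal.coe_ne_top _ this

/-- First-order condition at the proximal point: compare p with (1 - t)p + tx, divide by t and let t
→ 0. -/
theorem IsProperLscConvex.exists_mem_subdiffResolventSet (hf : IsProperLscConvex f) (z : Space d) :
    ∃ p, p ∈ subdiffResolventSet f z := by
  obtain ⟨p, a, ha, hmin⟩ := hf.exists_prox z
  refine ⟨p, fun x => ?_⟩
  by_cases hx : f x = ⊤
  · rw [hx]; exact le_top
  obtain ⟨b, hb⟩ : ∃ b : ℝ, f x = b := ⟨_, (EReal.coe_toReal hx (hf.ne_bot x)).symm⟩
  rw [ha, hb]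
  norm_cast
  have key : ∀ t : ℝ, 0 < t → t ≤ 1 →
      a + inner ℝ (z - p) (x - p) ≤ b + t * (1 / 2 * ‖x - p‖ ^ 2) := by
    intro t ht ht1
    have h1 := hmin _ _ (hf.le_combo ha.le hb.le (s := 1 - t) (by linarith) ht.le (by ring))
    have e : (1 - t) • p + t • x - z = t • (x - p) - (z - p) := by module
    rw [e, norm_sub_rev p z, norm_sub_sq_real (t • (x - p)), real_inner_smul_left, norm_smul,
      mul_pow, Real.norm_eq_abs, sq_abs, real_inner_comm] at h1
    have : t * (a + inner ℝ (z - p) (x - p)) ≤ t * (b + t * (1 / 2 * ‖x - p‖ ^ 2)) := by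
      linarith
    exact le_of_mul_le_mul_left this ht
  have hlim : Filter.Tendsto (fun t : ℝ => b + t * (1 / 2 * ‖x - p‖ ^ 2))
      (nhdsWithin 0 (Ioi 0)) (nhds (b + 0 * (1 / 2 * ‖x - p‖ ^ 2))) := by
    refine Filter.Tendsto.mono_left ?_ nhdsWithin_le_nhds
    exact Continuous.tendsto (by fun_prop) 0
  rw [zero_mul, add_zero] at hlim
  refine ge_of_tendsto hlim ?_
  filter_upwards [Ioc_mem_nhdsGT (zero_lt_one' ℝ)] with t ht using key t ht.1 ht.2

/-- Monotonicity of ∂f: each subgradient inequality is tested at the other point and the two are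
added. This yields uniqueness, and the continuity of the resolvent that makes the integrand
measurable. -/
theorem IsProperLscConvex.norm_sub_le_of_mem (hf : IsProperLscConvex f) {z w p q : Space d}
    (hp : p ∈ subdiffResolventSet f z) (hq : q ∈ subdiffResolventSet f w) :
    ‖p - q‖ ≤ ‖z - w‖ := by
  obtain ⟨a, ha⟩ := eq_coe_of_mem_subdifferential hf hp
  obtain ⟨b, hb⟩ := eq_coe_of_mem_subdifferential hf hq
  have h1 := hp q
  have h2 := hq p
  rw [ha, hb] at h1 h2
  norm_cast at h1 h2
  have e : inner ℝ (z - p) (q - p) + inner ℝ (w - q) (p - q)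
      = ‖p - q‖ ^ 2 - inner ℝ (z - w) (p - q) := by
    rw [← real_inner_self_eq_norm_sq, ← neg_sub p q, inner_neg_right]
    simp only [inner_sub_left]
    ring
  have hcs := real_inner_le_norm (z - w) (p - q)
  have : ‖p - q‖ * ‖p - q‖ ≤ ‖z - w‖ * ‖p - q‖ := by nlinarith
  rcases (norm_nonneg (p - q)).eq_or_lt with h | h
  · rw [← h]; exact norm_nonneg _
  · exact le_of_mul_le_mul_right this h

theorem IsProperLscConvex.existsUnique_mem_subdiffResolventSet (hf : IsProperLscConvex f)
    (z : Space d) : ∃! p, p ∈ subdiffResolventSet f z := by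
  obtain ⟨p, hp⟩ := hf.exists_mem_subdiffResolventSet z
  refine ⟨p, hp, fun q hq => ?_⟩
  have := hf.norm_sub_le_of_mem hq hp
  rwa [sub_self, norm_zero, norm_le_zero_iff, sub_eq_zero] at this

theorem IsProperLscConvex.subdiffResolvent_mem (hf : IsProperLscConvex f) (z : Space d) :
    subdiffResolvent f z ∈ subdiffResolventSet f z :=
  Classical.epsilon_spec (hf.exists_mem_subdiffResolventSet z)

theorem IsProperLscConvex.lipschitzWith_subdiffResolvent (hf : IsProperLscConvex f) :
    LipschitzWith 1 (subdiffResolvent f) :=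
  LipschitzWith.of_dist_le_mul fun z w => by
    simpa [dist_eq_norm] using
      hf.norm_sub_le_of_mem (hf.subdiffResolvent_mem z) (hf.subdiffResolvent_mem w)

/-- Minty's trick: the duality gap `f(x) + f^*(y) - x ⬝ y` controls `|x - (id + ∂f)⁻¹(x + y)|²`. -/
theorem IsProperLscConvex.norm_sub_subdiffResolvent_sq_le (hf : IsProperLscConvex f)
    {x y : Space d} {a b : ℝ} (hx : f x = a) (hy : conjugate f y = b) :
    ‖x - subdiffResolvent f (x + y)‖ ^ 2 ≤ a + b - inner ℝ x y := by
  have hp := hf.subdiffResolvent_mem (x + y)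
  set p := subdiffResolvent f (x + y)
  obtain ⟨c, hc⟩ := eq_coe_of_mem_subdifferential hf hp
  have h1 := hp x
  rw [hc, hx] at h1
  norm_cast at h1
  have h2 : ((inner ℝ p y : ℝ) : EReal) - f p ≤ conjugate f y :=
    le_iSup (fun x => ((inner ℝ x y : ℝ) : EReal) - f x) p
  rw [hc, hy] at h2
  norm_cast at h2
  -- The first inner product is at most a - c by `h1`, and ⟨p, y⟩ is at most b + c by `h2`.
  have e : ‖x - p‖ ^ 2 = inner ℝ (x + y - p) (x - p) + inner ℝ p y - inner ℝ x y := by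
    have : x + y - p = (x - p) + y := by abel
    rw [this, inner_add_left, real_inner_self_eq_norm_sq, inner_sub_right, real_inner_comm x y,
      real_inner_comm p y]
    ring
  linarith

theorem IsProperLscConvex.conjugate_ne_bot (hf : IsProperLscConvex f) (y : Space d) :
    conjugate f y ≠ ⊥ := by
  obtain ⟨x, a, hx⟩ := hf.exists_eq_coe
  have h : ((inner ℝ x y : ℝ) : EReal) - f x ≤ conjugate f y :=
    le_iSup (fun x => ((inner ℝ x y : ℝ) : EReal) - f x) x
  intro hbot
  rw [hx, hbot, le_bot_iff, ← EReal.coe_sub] at h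
  exact EReal.coe_ne_bot _ h

theorem IsProperLscConvex.lowerSemicontinuous_conjugate (hf : IsProperLscConvex f) :
    LowerSemicontinuous (conjugate f) := by
  refine lowerSemicontinuous_iSup fun x => Continuous.lowerSemicontinuous ?_
  by_cases hx : f x = ⊤
  · simp only [hx, EReal.sub_top]
    exact continuous_const
  · obtain ⟨a, ha⟩ : ∃ a : ℝ, f x = a := ⟨_, (EReal.coe_toReal hx (hf.ne_bot x)).symm⟩
    simp only [ha, ← EReal.coe_sub]
    exact continuous_coe_real_ereal.comp (by fun_prop)

end EntropicOT

/-! ### Couplings and the integrated duality gap. -/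

namespace EntropicOT

variable {d : ℕ} {μ ν : Measure (Space d)} {γ γ₀ : Measure (Space d × Space d)}
  {f : Space d → EReal}

theorem IsCoupling.ae_fst (h : IsCoupling μ ν γ) {p : Space d → Prop} (hp : ∀ᵐ x ∂μ, p x) :
    ∀ᵐ q ∂γ, p q.1 := by
  rw [← h.1] at hp
  exact ae_of_ae_map measurable_fst.aemeasurable hp

theorem IsCoupling.ae_snd (h : IsCoupling μ ν γ) {p : Space d → Prop} (hp : ∀ᵐ y ∂ν, p y) :
    ∀ᵐ q ∂γ, p q.2 := by
  rw [← h.2] at hp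
  exact ae_of_ae_map measurable_snd.aemeasurable hp

theorem IsCoupling.isProbabilityMeasure [IsProbabilityMeasure μ] (h : IsCoupling μ ν γ) :
    IsProbabilityMeasure γ :=
  ⟨by rw [← Measure.fst_univ, h.1, measure_univ]⟩

theorem IsCoupling.integral_fst (h : IsCoupling μ ν γ) {g : Space d → ℝ}
    (hg : AEStronglyMeasurable g μ) : ∫ q, g q.1 ∂γ = ∫ x, g x ∂μ := by
  rw [← h.1] at hg ⊢
  exact (integral_map measurable_fst.aemeasurable hg).symm

theorem IsCoupling.integral_snd (h : IsCoupling μ ν γ) {g : Space d → ℝ}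
    (hg : AEStronglyMeasurable g ν) : ∫ q, g q.2 ∂γ = ∫ y, g y ∂ν := by
  rw [← h.2] at hg ⊢
  exact (integral_map measurable_snd.aemeasurable hg).symm

theorem IsCoupling.integrable_fst (h : IsCoupling μ ν γ) {g : Space d → ℝ}
    (hg : Integrable g μ) : Integrable (fun q => g q.1) γ := by
  rw [← h.1] at hg
  exact hg.comp_measurable measurable_fst

theorem IsCoupling.integrable_snd (h : IsCoupling μ ν γ) {g : Space d → ℝ}
    (hg : Integrable g ν) : Integrable (fun q => g q.2) γ := by
  rw [← h.2] at hg
  exact hg.comp_measurable measurable_snd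

theorem integrable_of_ae_norm_le [IsFiniteMeasure γ] {R : ℝ}
    (hR : ∀ᵐ q ∂γ, ‖q.1‖ ≤ R ∧ ‖q.2‖ ≤ R) {g : Space d × Space d → ℝ} (hg : Continuous g) :
    Integrable g γ := by
  obtain ⟨M, hM⟩ := ((isCompact_closedBall (0 : Space d) R).prod
    (isCompact_closedBall (0 : Space d) R)).exists_bound_of_continuousOn hg.continuousOn
  refine Integrable.of_bound hg.aestronglyMeasurable M ?_
  filter_upwards [hR] with q hq
  exact hM q (by simpa using hq)

theorem IsCoupling.ae_norm_le (h : IsCoupling μ ν γ) {R : ℝ} (hμ : ∀ᵐ x ∂μ, ‖x‖ ≤ R)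
    (hν : ∀ᵐ y ∂ν, ‖y‖ ≤ R) : ∀ᵐ q ∂γ, ‖q.1‖ ≤ R ∧ ‖q.2‖ ≤ R :=
  (h.ae_fst hμ).and (h.ae_snd hν)

/-- The second moments depend only on the marginals, so minimising the cost amounts to maximising ∫
x ⬝ y. -/
theorem IsCoupling.transportCost_eq [IsProbabilityMeasure μ] [IsProbabilityMeasure ν]
    (h : IsCoupling μ ν γ) {R : ℝ} (hμ : ∀ᵐ x ∂μ, ‖x‖ ≤ R) (hν : ∀ᵐ y ∂ν, ‖y‖ ≤ R) :
    transportCost γ = ENNReal.ofReal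
      (1 / 2 * ∫ x, ‖x‖ ^ 2 ∂μ + 1 / 2 * ∫ y, ‖y‖ ^ 2 ∂ν - ∫ q, inner ℝ q.1 q.2 ∂γ) := by
  have := h.isProbabilityMeasure
  have hR := h.ae_norm_le hμ hν
  rw [transportCost, ← ofReal_integral_eq_lintegral_ofReal
    (integrable_of_ae_norm_le hR (by fun_prop)) (ae_of_all _ fun q => by positivity)]
  congr 1
  rw [← h.integral_fst (g := fun x => ‖x‖ ^ 2) (by fun_prop),
    ← h.integral_snd (g := fun x => ‖x‖ ^ 2) (by fun_prop), ← integral_const_mul,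
    ← integral_const_mul, ← integral_add, ← integral_sub]
  · congr 1 with q
    rw [norm_sub_sq_real]
    ring
  all_goals exact integrable_of_ae_norm_le hR (by fun_prop)

/-- Both potentials are finite and bounded almost everywhere. -/
theorem ae_bounded_potentials [IsProbabilityMeasure μ] [IsProbabilityMeasure ν]
    (hf : IsProperLscConvex f) {R : ℝ} (hμ : ∀ᵐ x ∂μ, ‖x‖ ≤ R)
    (hν : ∀ᵐ y ∂ν, ‖y‖ ≤ R) (h₀ : IsCoupling μ ν γ₀) (hsupp : γ₀.support ⊆ contactSet f) :
    ∃ M : ℝ, (∀ᵐ x ∂μ, f x = ((f x).toReal : EReal) ∧ |(f x).toReal| ≤ M) ∧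
      (∀ᵐ y ∂ν, conjugate f y = ((conjugate f y).toReal : EReal) ∧
        |(conjugate f y).toReal| ≤ M) ∧
      ∀ᵐ q ∂γ₀, (f q.1).toReal + (conjugate f q.2).toReal = inner ℝ q.1 q.2 := by
  have := h₀.isProbabilityMeasure
  obtain ⟨m, hm⟩ := exists_real_le_of_isCompact hf.lsc hf.ne_bot
    (isCompact_closedBall (0 : Space d) R)
  obtain ⟨n, hn⟩ := exists_real_le_of_isCompact hf.lowerSemicontinuous_conjugate
    hf.conjugate_ne_bot (isCompact_closedBall (0 : Space d) R)
  -- Both potentials are bounded below on the ball, and on the contact set their sum is at most R²,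
  -- so each is also bounded above.
  have hgood : ∀ᵐ q ∂γ₀, (f q.1 = ((f q.1).toReal : EReal) ∧
      |(f q.1).toReal| ≤ R * R + |m| + |n|) ∧
      (conjugate f q.2 = ((conjugate f q.2).toReal : EReal) ∧
        |(conjugate f q.2).toReal| ≤ R * R + |m| + |n|) ∧
      (f q.1).toReal + (conjugate f q.2).toReal = inner ℝ q.1 q.2 := by
    filter_upwards [Measure.support_mem_ae (μ := γ₀), h₀.ae_norm_le hμ hν] with q hq hR
    have hc : f q.1 + conjugate f q.2 = ((inner ℝ q.1 q.2 : ℝ) : EReal) := hsupp hq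
    have h1 : f q.1 ≠ ⊤ := fun h => by
      rw [h, EReal.top_add_of_ne_bot (hf.conjugate_ne_bot _)] at hc
      exact EReal.coe_ne_top _ hc.symm
    have h2 : conjugate f q.2 ≠ ⊤ := fun h => by
      rw [h, EReal.add_top_of_ne_bot (hf.ne_bot _)] at hc
      exact EReal.coe_ne_top _ hc.symm
    obtain ⟨a, ha⟩ : ∃ a : ℝ, f q.1 = a := ⟨_, (EReal.coe_toReal h1 (hf.ne_bot _)).symm⟩
    obtain ⟨b, hb⟩ : ∃ b : ℝ, conjugate f q.2 = b :=
      ⟨_, (EReal.coe_toReal h2 (hf.conjugate_ne_bot _)).symm⟩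
    have hma := hm q.1 (by simpa using hR.1)
    have hnb := hn q.2 (by simpa using hR.2)
    rw [ha] at hma
    rw [hb] at hnb
    rw [ha, hb] at hc
    rw [ha, hb]
    norm_cast at hma hnb hc
    have hin : inner ℝ q.1 q.2 ≤ R * R := (real_inner_le_norm _ _).trans
      (mul_le_mul hR.1 hR.2 (norm_nonneg _) ((norm_nonneg _).trans hR.1))
    have hRR : 0 ≤ R * R := mul_self_nonneg R
    have h1 := neg_abs_le m
    have h2 := neg_abs_le n
    have h3 := abs_nonneg m
    have h4 := abs_nonneg n
    simp only [EReal.toReal_coe, true_and]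
    exact ⟨abs_le.2 ⟨by linarith, by linarith⟩, abs_le.2 ⟨by linarith, by linarith⟩, hc⟩
  -- Measurability of these sets lets the γ₀-almost sure bounds descend to the marginals.
  have hmeas : ∀ g : Space d → EReal, LowerSemicontinuous g → ∀ M : ℝ,
      MeasurableSet {x | g x = ((g x).toReal : EReal) ∧ |(g x).toReal| ≤ M} := by
    intro g hg M
    have h1 := hg.measurable
    have h2 : MeasurableSet {x | g x = ((g x).toReal : EReal)} :=
      measurableSet_eq_fun h1 (by fun_prop)
    have h3 : MeasurableSet {x | |(g x).toReal| ≤ M} :=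
      measurableSet_le h1.ereal_toReal.abs measurable_const
    exact h2.inter h3
  refine ⟨R * R + |m| + |n|, ?_, ?_, hgood.mono fun q h => h.2.2⟩
  · have := (ae_map_iff (μ := γ₀) measurable_fst.aemeasurable (hmeas f hf.lsc _)).2
      (hgood.mono fun q h => h.1)
    rwa [← Measure.fst, h₀.1] at this
  · have := (ae_map_iff (μ := γ₀) measurable_snd.aemeasurable
      (hmeas _ hf.lowerSemicontinuous_conjugate _)).2 (hgood.mono fun q h => h.2.1)
    rwa [← Measure.snd, h₀.2] at this

/-- The squared deviation of a coupling from the graph of `∂f`, measured through the resolvent,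
is at most the suboptimality of the coupling. -/
theorem integral_norm_sub_subdiffResolvent_sq_le [IsProbabilityMeasure μ] [IsProbabilityMeasure ν]
    (hf : IsProperLscConvex f) {R : ℝ} (hμ : ∀ᵐ x ∂μ, ‖x‖ ≤ R)
    (hν : ∀ᵐ y ∂ν, ‖y‖ ≤ R) (h₀ : IsCoupling μ ν γ₀) (hsupp : γ₀.support ⊆ contactSet f)
    (h : IsCoupling μ ν γ) :
    Integrable (fun q => ‖q.1 - subdiffResolvent f (q.1 + q.2)‖ ^ 2) γ ∧
      ∫ q, ‖q.1 - subdiffResolvent f (q.1 + q.2)‖ ^ 2 ∂γ ≤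
        ∫ q, inner ℝ q.1 q.2 ∂γ₀ - ∫ q, inner ℝ q.1 q.2 ∂γ := by
  have := h.isProbabilityMeasure
  have := h₀.isProbabilityMeasure
  obtain ⟨M, h1, h2, h3⟩ := ae_bounded_potentials hf hμ hν h₀ hsupp
  have i1 : Integrable (fun x => (f x).toReal) μ :=
    Integrable.of_bound hf.lsc.measurable.ereal_toReal.aestronglyMeasurable M
      (h1.mono fun x hx => hx.2)
  have i2 : Integrable (fun y => (conjugate f y).toReal) ν :=
    Integrable.of_bound
      hf.lowerSemicontinuous_conjugate.measurable.ereal_toReal.aestronglyMeasurable M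
      (h2.mono fun x hx => hx.2)
  have i3 : Integrable (fun q => inner ℝ q.1 q.2) γ :=
    integrable_of_ae_norm_le (h.ae_norm_le hμ hν) (by fun_prop)
  have hcont : Continuous (fun q : Space d × Space d =>
      ‖q.1 - subdiffResolvent f (q.1 + q.2)‖ ^ 2) := by
    have := hf.lipschitzWith_subdiffResolvent.continuous
    fun_prop
  have hint := integrable_of_ae_norm_le (h.ae_norm_le hμ hν) hcont
  refine ⟨hint, ?_⟩
  have j1 := h.integrable_fst i1
  have j2 := h.integrable_snd i2
  have e₀ : ∫ x, (f x).toReal ∂μ + ∫ y, (conjugate f y).toReal ∂ν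
      = ∫ q, inner ℝ q.1 q.2 ∂γ₀ := by
    rw [← h₀.integral_fst i1.1, ← h₀.integral_snd i2.1,
      ← integral_add (h₀.integrable_fst i1) (h₀.integrable_snd i2)]
    exact integral_congr_ae h3
  rw [← e₀, ← h.integral_fst i1.1, ← h.integral_snd i2.1, ← integral_add j1 j2,
    ← integral_sub (by exact j1.add j2) i3]
  refine integral_mono_ae hint ((j1.add j2).sub i3) ?_
  filter_upwards [h.ae_fst h1, h.ae_snd h2] with q hq1 hq2
  exact hf.norm_sub_subdiffResolvent_sq_le hq1.1 hq2.1

end EntropicOT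

/-! ### Existence of an optimal plan. -/

namespace EntropicOT

variable {d : ℕ} {μ ν : Measure (Space d)}

theorem isCoupling_prod [IsProbabilityMeasure μ] [IsProbabilityMeasure ν] :
    IsCoupling μ ν (μ.prod ν) := ⟨Measure.fst_prod, Measure.snd_prod⟩

/-- Couplings of two measures carried by a ball form a weakly compact set. -/
theorem isCompact_setOf_isCoupling [IsProbabilityMeasure μ] [IsProbabilityMeasure ν] {R : ℝ}
    (hμ : ∀ᵐ x ∂μ, ‖x‖ ≤ R) (hν : ∀ᵐ y ∂ν, ‖y‖ ≤ R) :
    IsCompact {P : ProbabilityMeasure (Space d × Space d) |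
      IsCoupling μ ν (P : Measure (Space d × Space d))} := by
  have hK := (isCompact_closedBall (0 : Space d) R).prod (isCompact_closedBall (0 : Space d) R)
  -- Tightness is trivial: every coupling gives mass 0 to the complement of one fixed compact set.
  refine (isCompact_setOfPred_probabilityMeasure_mass_eq_compl_isCompact_le (u := fun _ => 0)
    tendsto_const_nhds (fun _ : ℕ => hK) (Or.inr monotone_const)).of_isClosed_subset ?_ ?_
  · let μ' : ProbabilityMeasure (Space d) := ⟨μ, inferInstance⟩
    let ν' : ProbabilityMeasure (Space d) := ⟨ν, inferInstance⟩
    have h1 : IsClosed {P : ProbabilityMeasure (Space d × Space d) |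
        P.map continuous_fst.measurable.aemeasurable = μ'} :=
      isClosed_eq (ProbabilityMeasure.continuous_map continuous_fst) continuous_const
    have h2 : IsClosed {P : ProbabilityMeasure (Space d × Space d) |
        P.map continuous_snd.measurable.aemeasurable = ν'} :=
      isClosed_eq (ProbabilityMeasure.continuous_map continuous_snd) continuous_const
    convert h1.inter h2 using 1
    ext P
    simp only [mem_ofPred_eq, mem_inter_iff, ← ProbabilityMeasure.toMeasure_injective.eq_iff]
    rfl
  · intro P hP n
    have := hP.ae_norm_le hμ hν
    rw [ae_iff] at this
    have e : (Metric.closedBall (0 : Space d) R ×ˢ Metric.closedBall (0 : Space d) R)ᶜ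
        = {a | ¬(‖a.1‖ ≤ R ∧ ‖a.2‖ ≤ R)} := by
      ext q; simp
    rw [e, ProbabilityMeasure.null_iff_toMeasure_null _ _ |>.2 this]

theorem exists_isOptimalPlan [IsProbabilityMeasure μ] [IsProbabilityMeasure ν] {R : ℝ}
    (hμ : ∀ᵐ x ∂μ, ‖x‖ ≤ R) (hν : ∀ᵐ y ∂ν, ‖y‖ ≤ R) : ∃ γ, IsOptimalPlan μ ν γ := by
  -- Clipping x ⬝ y at ±R² makes it a bounded continuous test function without changing its integral
  -- against any coupling.
  let g : BoundedContinuousFunction (Space d × Space d) ℝ :=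
    BoundedContinuousFunction.ofNormedAddCommGroup
      (fun q => max (-(R * R)) (min (inner ℝ q.1 q.2) (R * R))) (by fun_prop) (R * R) (by
        intro q
        have : 0 ≤ R * R := mul_self_nonneg R
        exact abs_le.2 ⟨le_max_left _ _, max_le (by linarith) (min_le_right _ _)⟩)
  have hg : ∀ γ, IsCoupling μ ν γ → ∫ q, inner ℝ q.1 q.2 ∂γ = ∫ q, g q ∂γ := by
    intro γ hγ
    refine integral_congr_ae ?_
    filter_upwards [hγ.ae_norm_le hμ hν] with q hq
    have hin := abs_le.1 ((abs_real_inner_le_norm q.1 q.2).trans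
      (mul_le_mul hq.1 hq.2 (norm_nonneg _) ((norm_nonneg _).trans hq.1)))
    change _ = max (-(R * R)) (min (inner ℝ q.1 q.2) (R * R))
    rw [min_eq_left hin.2, max_eq_right hin.1]
  obtain ⟨P, hP, hmax⟩ := (isCompact_setOf_isCoupling hμ hν).exists_isMaxOn
    ⟨⟨μ.prod ν, inferInstance⟩, isCoupling_prod⟩
    (ProbabilityMeasure.continuous_integral_boundedContinuousFunction g).continuousOn
  refine ⟨P, hP, fun γ hγ => ?_⟩
  have := hγ.isProbabilityMeasure
  rw [hP.transportCost_eq hμ hν, hγ.transportCost_eq hμ hν, hg _ hP, hg _ hγ]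
  have := hmax (show (⟨γ, inferInstance⟩ : ProbabilityMeasure _) ∈ _ from hγ)
  exact ENNReal.ofReal_le_ofReal (sub_le_sub_left this _)

end EntropicOT

/-! ### Entropy bounds and the block approximation of a coupling. -/

namespace EntropicOT

section Entropy

variable {α : Type*} [MeasurableSpace α]

/-- The relative entropy is bounded by the logarithm of the second moment of the density. -/
theorem klDiv_le_log_of_lintegral_rnDeriv_le {P Q : Measure α} [IsProbabilityMeasure P]
    [IsProbabilityMeasure Q] (hPQ : P ≪ Q) {N : ℝ} (hN : 0 < N)
    (h : ∫⁻ x, P.rnDeriv Q x ∂P ≤ ENNReal.ofReal N) :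
    InformationTheory.klDiv P Q ≤ ENNReal.ofReal (Real.log N) := by
  set ρ : α → ℝ := fun x => (P.rnDeriv Q x).toReal with hρ
  have hρm : Measurable ρ := (Measure.measurable_rnDeriv P Q).ennreal_toReal
  have hsq : ∫⁻ x, ENNReal.ofReal (ρ x ^ 2) ∂Q ≤ ENNReal.ofReal N := by
    rw [← lintegral_rnDeriv_mul hPQ (Measure.measurable_rnDeriv P Q).aemeasurable] at h
    refine (lintegral_mono_ae ?_).trans h
    filter_upwards [P.rnDeriv_ne_top Q] with x hx
    rw [pow_two, ENNReal.ofReal_mul ENNReal.toReal_nonneg, ENNReal.ofReal_toReal hx]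
  have i2 : Integrable (fun x => ρ x ^ 2) Q := by
    refine ⟨(hρm.pow_const 2).aestronglyMeasurable, ?_⟩
    rw [hasFiniteIntegral_iff_ofReal (ae_of_all _ fun x => sq_nonneg _)]
    exact hsq.trans_lt ENNReal.ofReal_lt_top
  have i1 : Integrable ρ Q := Measure.integrable_toReal_rnDeriv
  have hsq' : ∫ x, ρ x ^ 2 ∂Q ≤ N := by
    rw [integral_eq_lintegral_of_nonneg_ae (ae_of_all _ fun x => sq_nonneg _)
      (hρm.pow_const 2).aestronglyMeasurable]
    exact ENNReal.toReal_le_of_le_ofReal hN.le hsq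
  have hone : ∫ x, ρ x ∂Q = 1 := by
    rw [hρ, Measure.integral_toReal_rnDeriv hPQ, probReal_univ]
  -- This is log t ≤ t - 1 at t = ρ/N, multiplied by ρ. With ∫ ρ = 1 and ∫ ρ² ≤ N the right side
  -- integrates to at most log N.
  have hpt : ∀ x, InformationTheory.klFun (ρ x) ≤
      (Real.log N - 2) * ρ x + N⁻¹ * ρ x ^ 2 + 1 := by
    intro x
    have h0 : 0 ≤ ρ x := ENNReal.toReal_nonneg
    rw [InformationTheory.klFun_apply]
    rcases h0.eq_or_lt with h0 | h0
    · simp [← h0]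
    have h1 := Real.log_le_sub_one_of_pos (div_pos h0 hN)
    rw [Real.log_div h0.ne' hN.ne'] at h1
    have h2 := mul_le_mul_of_nonneg_left h1 h0.le
    have h3 : ρ x * (ρ x / N) = N⁻¹ * ρ x ^ 2 := by ring
    linarith
  rw [InformationTheory.klDiv_eq_lintegral_klFun_of_ac hPQ]
  have j1 := (i1.const_mul (Real.log N - 2)).add (i2.const_mul N⁻¹)
  calc ∫⁻ x, ENNReal.ofReal (InformationTheory.klFun (ρ x)) ∂Q
      ≤ ∫⁻ x, ENNReal.ofReal ((Real.log N - 2) * ρ x + N⁻¹ * ρ x ^ 2 + 1) ∂Q :=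
        lintegral_mono fun x => ENNReal.ofReal_le_ofReal (hpt x)
    _ = ENNReal.ofReal (∫ x, ((Real.log N - 2) * ρ x + N⁻¹ * ρ x ^ 2 + 1) ∂Q) :=
        (ofReal_integral_eq_lintegral_ofReal (j1.add (integrable_const 1))
          (ae_of_all _ fun x =>
            (InformationTheory.klFun_nonneg ENNReal.toReal_nonneg).trans (hpt x))).symm
    _ ≤ ENNReal.ofReal (Real.log N) := by
        refine ENNReal.ofReal_le_ofReal ?_
        rw [integral_add (by exact j1) (integrable_const 1),
          integral_add (i1.const_mul _) (i2.const_mul _), integral_const_mul, integral_const_mul,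
          hone, integral_const, probReal_univ]
        have : N⁻¹ * ∫ x, ρ x ^ 2 ∂Q ≤ 1 := by
          rw [inv_mul_le_iff₀ hN]; linarith
        simp only [smul_eq_mul]
        linarith

theorem rnDeriv_le_of_le_withDensity {P Q : Measure α} [SigmaFinite Q] {g : α → ℝ≥0∞}
    (h : P ≤ Q.withDensity g) : P.rnDeriv Q ≤ᵐ[Q] g := by
  refine ae_le_of_forall_setLIntegral_le_of_sigmaFinite (P.measurable_rnDeriv Q) fun s hs _ => ?_
  rw [← withDensity_apply g hs]
  exact (Measure.setLIntegral_rnDeriv_le s).trans (h s)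

theorem sum_restrict_preimage_singleton {ι : Type*} [Countable ι] [MeasurableSpace ι]
    [MeasurableSingletonClass ι] {T : α → ι} (hT : Measurable T) (P : Measure α) :
    Measure.sum (fun j => P.restrict (T ⁻¹' {j})) = P := by
  rw [← Measure.restrict_iUnion (fun i j hij => ?_) fun j => hT (measurableSet_singleton j),
    ← preimage_iUnion, iUnion_of_singleton, preimage_univ, Measure.restrict_univ]
  exact Disjoint.preimage _ (disjoint_singleton.2 hij)

end Entropy

section Block

variable {d : ℕ} {μ ν : Measure (Space d)} {γ₀ : Measure (Space d × Space d)}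
  {ι : Type*} [MeasurableSpace ι] [MeasurableSingletonClass ι] {T : Space d → ι}

theorem IsCoupling.restrict_cell_univ (h : IsCoupling μ ν γ₀) (hT : Measurable T) (j : ι) :
    γ₀.restrict ((T ∘ Prod.snd) ⁻¹' {j}) univ = ν (T ⁻¹' {j}) := by
  rw [Measure.restrict_apply_univ, ← h.2, Measure.snd_apply (hT (measurableSet_singleton j))]
  rfl

variable [Countable ι]

/-- Given `γ₀` and a partition of the second factor into the fibres of `T`, the law of
`(x, y, y')` where `(x, y)` has law `γ₀` and `y'` is resampled from `ν` in the cell of `y`. -/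
noncomputable def blockResampling (ν : Measure (Space d)) (γ₀ : Measure (Space d × Space d))
    (T : Space d → ι) : Measure ((Space d × Space d) × Space d) :=
  Measure.sum fun j =>
    (γ₀.restrict ((T ∘ Prod.snd) ⁻¹' {j})).prod (ProbabilityTheory.cond ν (T ⁻¹' {j}))

theorem IsCoupling.fst_blockResampling [IsProbabilityMeasure ν] (h : IsCoupling μ ν γ₀)
    (hT : Measurable T) : (blockResampling ν γ₀ T).fst = γ₀ := by
  have hT' : Measurable (T ∘ Prod.snd (α := Space d)) := hT.comp measurable_snd
  conv_rhs => rw [← sum_restrict_preimage_singleton hT' γ₀]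
  rw [blockResampling, Measure.fst_sum]
  congr 1
  ext1 j
  -- On a ν-null cell `cond` is not a probability measure, but γ₀ has no mass there either.
  by_cases hj : ν (T ⁻¹' {j}) = 0
  · have : γ₀.restrict ((T ∘ Prod.snd) ⁻¹' {j}) = 0 := by
      rw [← Measure.measure_univ_eq_zero, h.restrict_cell_univ hT, hj]
    simp [this]
  · have := ProbabilityTheory.cond_isProbabilityMeasure hj
    exact Measure.fst_prod

theorem IsCoupling.snd_blockResampling [IsProbabilityMeasure μ] [IsProbabilityMeasure ν]
    (h : IsCoupling μ ν γ₀) (hT : Measurable T) : (blockResampling ν γ₀ T).snd = ν := by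
  have := h.isProbabilityMeasure
  conv_rhs => rw [← sum_restrict_preimage_singleton hT ν]
  rw [blockResampling, Measure.snd_sum]
  congr 1
  ext1 j
  rw [Measure.snd, Measure.map_snd_prod, h.restrict_cell_univ hT]
  by_cases hj : ν (T ⁻¹' {j}) = 0
  · rw [hj, zero_smul, Measure.restrict_eq_zero.2 hj]
  · rw [ProbabilityTheory.cond, smul_smul, ENNReal.mul_inv_cancel hj (measure_ne_top _ _), one_smul]

theorem ae_blockResampling [IsProbabilityMeasure γ₀] [IsProbabilityMeasure ν]
    (hT : Measurable T) : ∀ᵐ q ∂blockResampling ν γ₀ T, T q.1.2 = T q.2 := by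
  refine (Measure.ae_sum_iff).2 fun j => ?_
  have h1 : ∀ᵐ q ∂γ₀.restrict ((T ∘ Prod.snd) ⁻¹' {j}), T q.2 = j :=
    ae_restrict_mem ((hT.comp measurable_snd) (measurableSet_singleton j))
  have h2 : ∀ᵐ y ∂ProbabilityTheory.cond ν (T ⁻¹' {j}), T y = j :=
    ProbabilityTheory.ae_cond_mem (hT (measurableSet_singleton j))
  filter_upwards [Measure.quasiMeasurePreserving_fst.ae h1,
    Measure.quasiMeasurePreserving_snd.ae h2] with q hq1 hq2
  rw [hq1, hq2]

/-- The law of `(x, y')` under `blockResampling`. -/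
noncomputable def blockPlan (ν : Measure (Space d)) (γ₀ : Measure (Space d × Space d))
    (T : Space d → ι) : Measure (Space d × Space d) :=
  (blockResampling ν γ₀ T).map fun q => (q.1.1, q.2)

theorem IsCoupling.isCoupling_blockPlan [IsProbabilityMeasure μ] [IsProbabilityMeasure ν]
    (h : IsCoupling μ ν γ₀) (hT : Measurable T) : IsCoupling μ ν (blockPlan ν γ₀ T) := by
  constructor
  · conv_rhs => rw [← h.1, ← h.fst_blockResampling hT]
    rw [blockPlan, Measure.fst, Measure.fst, Measure.fst,
      Measure.map_map (by fun_prop) (by fun_prop), Measure.map_map (by fun_prop) (by fun_prop)]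
    rfl
  · conv_rhs => rw [← h.snd_blockResampling hT]
    rw [blockPlan, Measure.snd, Measure.snd,
      Measure.map_map (by fun_prop) (by fun_prop)]
    rfl

/-- In each cell the plan is a product whose first factor is a part of μ and whose second is ν
restricted to the cell and divided by the cell's mass. -/
theorem IsCoupling.blockPlan_le_withDensity [IsProbabilityMeasure μ] [IsProbabilityMeasure ν]
    (h : IsCoupling μ ν γ₀) (hT : Measurable T) :
    blockPlan ν γ₀ T ≤
      (μ.prod ν).withDensity fun p => (ν (T ⁻¹' {T p.2}))⁻¹ := by
  have := h.isProbabilityMeasure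
  have hT' : Measurable (T ∘ Prod.snd (α := Space d)) := hT.comp measurable_snd
  rw [← sum_restrict_preimage_singleton hT' (μ.prod ν), withDensity_sum, blockPlan,
    blockResampling, Measure.map_sum (by fun_prop)]
  refine Measure.le_iff.2 fun s hs => ?_
  rw [Measure.sum_apply _ hs, Measure.sum_apply _ hs]
  refine ENNReal.tsum_le_tsum fun j => ?_
  have e1 : ((μ.prod ν).restrict ((T ∘ Prod.snd) ⁻¹' {j})).withDensity
      (fun p => (ν (T ⁻¹' {T p.2}))⁻¹) =
      (ν (T ⁻¹' {j}))⁻¹ • (μ.prod ν).restrict ((T ∘ Prod.snd) ⁻¹' {j}) := by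
    rw [← withDensity_const]
    refine withDensity_congr_ae ?_
    filter_upwards [ae_restrict_mem (hT' (measurableSet_singleton j))] with p hp
    rw [show T p.2 = j from hp]
  have e2 : (μ.prod ν).restrict ((T ∘ Prod.snd) ⁻¹' {j}) = μ.prod (ν.restrict (T ⁻¹' {j})) := by
    conv_rhs => rw [← Measure.restrict_univ (μ := μ)]
    rw [Measure.prod_restrict]
    congr 1
    ext p; simp
  have e3 : ((γ₀.restrict ((T ∘ Prod.snd) ⁻¹' {j})).prod
      (ProbabilityTheory.cond ν (T ⁻¹' {j}))).map (fun q => (q.1.1, q.2)) =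
      (γ₀.restrict ((T ∘ Prod.snd) ⁻¹' {j})).fst.prod
        (ProbabilityTheory.cond ν (T ⁻¹' {j})) := by
    rw [Measure.fst]
    conv_rhs => rw [← Measure.map_id (μ := ProbabilityTheory.cond ν (T ⁻¹' {j}))]
    rw [Measure.map_prod_map _ _ measurable_fst measurable_id]
    rfl
  have hle : (γ₀.restrict ((T ∘ Prod.snd) ⁻¹' {j})).fst ≤ μ := by
    rw [← h.1]
    exact Measure.map_mono Measure.restrict_le_self measurable_fst
  rw [e1, e2, e3, ← Measure.prod_smul_right]
  exact Measure.prod_mono hle le_rfl s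

/-- Each cell contributes its mass times the inverse of its mass, which is at most 1. -/
theorem lintegral_inv_measure_cell_le [IsProbabilityMeasure ν] (hT : Measurable T) {S : Finset ι}
    (hS : ∀ᵐ y ∂ν, T y ∈ S) : ∫⁻ y, (ν (T ⁻¹' {T y}))⁻¹ ∂ν ≤ S.card := by
  calc ∫⁻ y, (ν (T ⁻¹' {T y}))⁻¹ ∂ν
      = ∑' j, ∫⁻ y in T ⁻¹' {j}, (ν (T ⁻¹' {T y}))⁻¹ ∂ν := by
        rw [← lintegral_sum_measure, sum_restrict_preimage_singleton hT]
    _ = ∑' j, (ν (T ⁻¹' {j}))⁻¹ * ν (T ⁻¹' {j}) := by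
        congr 1 with j
        rw [← setLIntegral_const]
        refine setLIntegral_congr_fun (hT (measurableSet_singleton j)) fun y hy => ?_
        rw [show T y = j from hy]
    _ = ∑ j ∈ S, (ν (T ⁻¹' {j}))⁻¹ * ν (T ⁻¹' {j}) := by
        refine tsum_eq_sum fun j hj => ?_
        have : ν (T ⁻¹' {j}) = 0 := by
          refine measure_mono_null (fun y hy => ?_) (ae_iff.1 hS)
          change T y ∉ S
          rwa [show T y = j from hy]
        rw [this, mul_zero]
    _ ≤ ∑ j ∈ S, 1 := Finset.sum_le_sum fun j _ => ENNReal.inv_mul_le_one _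
    _ = S.card := by simp

/-- The density bound depends on y alone and the second marginal is ν, so the second moment of the
density is at most the number of cells. -/
theorem IsCoupling.klDiv_blockPlan_le [IsProbabilityMeasure μ] [IsProbabilityMeasure ν]
    (h : IsCoupling μ ν γ₀) (hT : Measurable T) {S : Finset ι} (hS : ∀ᵐ y ∂ν, T y ∈ S) :
    InformationTheory.klDiv (blockPlan ν γ₀ T) (μ.prod ν) ≤
      ENNReal.ofReal (Real.log S.card) := by
  have hc := h.isCoupling_blockPlan hT
  have := hc.isProbabilityMeasure
  have hle := h.blockPlan_le_withDensity hT
  have hac := (Measure.absolutelyContinuous_of_le hle).trans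
    (withDensity_absolutelyContinuous _ _)
  have hcard : 0 < S.card := by
    obtain ⟨y, hy⟩ := hS.exists
    exact Finset.card_pos.2 ⟨_, hy⟩
  refine klDiv_le_log_of_lintegral_rnDeriv_le hac (by exact_mod_cast hcard) ?_
  calc _ ≤ ∫⁻ p, (ν (T ⁻¹' {T p.2}))⁻¹ ∂blockPlan ν γ₀ T :=
        lintegral_mono_ae (hac.ae_le (rnDeriv_le_of_le_withDensity hle))
    _ = ∫⁻ y, (ν (T ⁻¹' {T y}))⁻¹ ∂ν := by
        have hg : Measurable fun j => (ν (T ⁻¹' {j}))⁻¹ := measurable_of_countable _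
        have hmap := lintegral_map (μ := blockPlan ν γ₀ T) (hg.comp hT) measurable_snd
        rw [← Measure.snd, hc.2] at hmap
        exact hmap.symm
    _ ≤ _ := by
        rw [ENNReal.ofReal_natCast]
        exact lintegral_inv_measure_cell_le hT hS

/-- `blockResampling` couples the two plans with the same x and with y, y' in the same cell. -/
theorem IsCoupling.integral_inner_sub_blockPlan_le [IsProbabilityMeasure μ]
    [IsProbabilityMeasure ν] (h : IsCoupling μ ν γ₀) (hT : Measurable T) {R δ : ℝ}
    (hμ : ∀ᵐ x ∂μ, ‖x‖ ≤ R) (hν : ∀ᵐ y ∂ν, ‖y‖ ≤ R)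
    (hδ : ∀ y y', T y = T y' → ‖y - y'‖ ≤ δ) :
    ∫ q, inner ℝ q.1 q.2 ∂γ₀ - ∫ q, inner ℝ q.1 q.2 ∂blockPlan ν γ₀ T ≤ R * δ := by
  have := h.isProbabilityMeasure
  have hc := h.isCoupling_blockPlan hT
  have := hc.isProbabilityMeasure
  have h1 := h.fst_blockResampling hT
  have hprob : IsProbabilityMeasure (blockResampling ν γ₀ T) :=
    ⟨by rw [← Measure.fst_univ, h1, measure_univ]⟩
  have e1 : ∫ q, inner ℝ q.1 q.2 ∂γ₀ = ∫ q, inner ℝ q.1.1 q.1.2 ∂blockResampling ν γ₀ T := by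
    conv_lhs => rw [← h1]
    exact integral_map measurable_fst.aemeasurable (by fun_prop)
  have e2 : ∫ q, inner ℝ q.1 q.2 ∂blockPlan ν γ₀ T =
      ∫ q, inner ℝ q.1.1 q.2 ∂blockResampling ν γ₀ T :=
    integral_map (φ := fun q : (Space d × Space d) × Space d => (q.1.1, q.2)) (by fun_prop)
      (by fun_prop)
  have i1 : Integrable (fun q => inner ℝ q.1.1 q.1.2) (blockResampling ν γ₀ T) := by
    have := integrable_of_ae_norm_le (γ := γ₀) (g := fun q => inner ℝ q.1 q.2)
      (h.ae_norm_le hμ hν) (by fun_prop)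
    rw [← h1] at this
    exact this.comp_measurable measurable_fst
  have i2 : Integrable (fun q => inner ℝ q.1.1 q.2) (blockResampling ν γ₀ T) :=
    (integrable_of_ae_norm_le (γ := blockPlan ν γ₀ T)
      (g := fun q => inner ℝ q.1 q.2) (hc.ae_norm_le hμ hν) (by fun_prop)).comp_measurable
      (f := fun q : (Space d × Space d) × Space d => (q.1.1, q.2)) (by fun_prop)
  have hb : ∀ᵐ q ∂blockResampling ν γ₀ T, ‖q.1.1‖ ≤ R := by
    have := h.ae_fst hμ
    rw [← h1] at this
    exact ae_of_ae_map measurable_fst.aemeasurable this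
  rw [e1, e2, ← integral_sub i1 i2]
  calc _ ≤ ∫ _, R * δ ∂blockResampling ν γ₀ T := by
        refine integral_mono_ae (i1.sub i2) (integrable_const _) ?_
        filter_upwards [hb, ae_blockResampling (γ₀ := γ₀) (ν := ν) hT] with q hq1 hq2
        change inner ℝ q.1.1 q.1.2 - inner ℝ q.1.1 q.2 ≤ R * δ
        rw [← inner_sub_right]
        exact (real_inner_le_norm _ _).trans (mul_le_mul hq1 (hδ _ _ hq2) (norm_nonneg _)
          ((norm_nonneg _).trans hq1))
    _ = R * δ := by simp

end Block

end EntropicOT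

/-! ### Cubes of side ε and the excess cost of the entropic plan. -/

namespace EntropicOT

variable {d : ℕ} {μ ν : Measure (Space d)} {γ₀ : Measure (Space d × Space d)}

/-- The index of the half-open cube of side `ε` containing a point. -/
noncomputable def cubeIndex (ε : ℝ) (y : Space d) : Fin d → ℤ := fun i => ⌊y i / ε⌋

theorem measurable_cubeIndex (ε : ℝ) : Measurable (cubeIndex (d := d) ε) :=
  measurable_pi_lambda _ fun i => Int.measurable_floor.comp (by fun_prop)

theorem norm_sub_le_of_cubeIndex_eq {ε : ℝ} (hε : 0 < ε) {y y' : Space d}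
    (h : cubeIndex ε y = cubeIndex ε y') : ‖y - y'‖ ≤ √d * ε := by
  have hi : ∀ i, ‖(y - y') i‖ ^ 2 ≤ ε ^ 2 := by
    intro i
    have h1 := Int.abs_sub_lt_one_of_floor_eq_floor (congrFun h i)
    rw [← sub_div, abs_div, abs_of_pos hε, div_lt_one hε] at h1
    rw [Real.norm_eq_abs]
    exact pow_le_pow_left₀ (abs_nonneg _) h1.le 2
  rw [EuclideanSpace.norm_eq]
  refine (Real.sqrt_le_sqrt (Finset.sum_le_sum fun i _ => hi i)).trans ?_
  rw [Finset.sum_const, Finset.card_univ, Fintype.card_fin, nsmul_eq_mul,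
    Real.sqrt_mul (Nat.cast_nonneg d), Real.sqrt_sq hε.le]

/-- A ball of radius `R` meets at most `((2R + 3) / ε) ^ d` cubes of side `ε ≤ 1`. -/
theorem exists_finset_cubeIndex_mem {R ε : ℝ} (hR : 0 ≤ R) (hε : 0 < ε) (hε1 : ε ≤ 1) :
    ∃ S : Finset (Fin d → ℤ), (∀ y : Space d, ‖y‖ ≤ R → cubeIndex ε y ∈ S) ∧
      (S.card : ℝ) ≤ ((2 * R + 3) / ε) ^ d := by
  -- The extra 1 covers rounding down of negative coordinates. There are 2m + 1 = 2⌊R/ε⌋ + 3 indices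
  -- per axis, and 3 ≤ 3/ε.
  set m : ℤ := ⌊R / ε⌋ + 1
  have hRε : 0 ≤ R / ε := by positivity
  have hm : 0 ≤ ⌊R / ε⌋ := Int.floor_nonneg.2 hRε
  refine ⟨Fintype.piFinset fun _ => Finset.Icc (-m) m, fun y hy => ?_, ?_⟩
  · refine Fintype.mem_piFinset.2 fun i => Finset.mem_Icc.2 ?_
    have h1 : |y i| ≤ R := (PiLp.norm_apply_le y i).trans hy
    have h2 : y i / ε ≤ R / ε := by gcongr; exact (abs_le.1 h1).2
    have h3 : -(R / ε) ≤ y i / ε := by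
      rw [← neg_div]; gcongr; exact (abs_le.1 h1).1
    have h4 := Int.lt_floor_add_one (R / ε)
    constructor
    · refine Int.le_floor.2 ?_
      push_cast [m]
      linarith
    · exact (Int.floor_le_floor h2).trans (by omega)
  · rw [Fintype.card_piFinset_const, Int.card_Icc]
    have h1 : ((m + 1 - -m).toNat : ℝ) = 2 * ⌊R / ε⌋ + 3 := by
      have : ((m + 1 - -m).toNat : ℤ) = 2 * ⌊R / ε⌋ + 3 := by
        rw [Int.toNat_of_nonneg (by omega)]; omega
      exact_mod_cast this
    push_cast
    rw [h1]
    refine pow_le_pow_left₀ (by positivity) ?_ _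
    have h2 := Int.floor_le (R / ε)
    have h3 : 1 ≤ 1 / ε := (one_le_div hε).2 hε1
    have h4 : (2 * R + 3) / ε = 2 * (R / ε) + 3 * (1 / ε) := by ring
    linarith

/-- A coupling with entropy of order `d log (1 / ε)` whose cost exceeds that of `γ₀`
by at most a multiple of `ε`. -/
theorem IsCoupling.exists_low_entropy [IsProbabilityMeasure μ] [IsProbabilityMeasure ν]
    (h : IsCoupling μ ν γ₀) {R ε : ℝ} (hR : 0 ≤ R) (hε : 0 < ε) (hε1 : ε ≤ 1)
    (hμ : ∀ᵐ x ∂μ, ‖x‖ ≤ R) (hν : ∀ᵐ y ∂ν, ‖y‖ ≤ R) :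
    ∃ γ, IsCoupling μ ν γ ∧
      ∫ q, inner ℝ q.1 q.2 ∂γ₀ - ∫ q, inner ℝ q.1 q.2 ∂γ ≤ R * (√d * ε) ∧
      InformationTheory.klDiv γ (μ.prod ν) ≤
        ENNReal.ofReal (d * Real.log (1 / ε) + d * Real.log (2 * R + 3)) := by
  obtain ⟨S, hS, hcard⟩ := exists_finset_cubeIndex_mem (d := d) hR hε hε1
  have hT := measurable_cubeIndex (d := d) ε
  have hS' : ∀ᵐ y ∂ν, cubeIndex ε y ∈ S := hν.mono hS
  refine ⟨blockPlan ν γ₀ (cubeIndex ε), h.isCoupling_blockPlan hT,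
    h.integral_inner_sub_blockPlan_le hT hμ hν fun y y' => norm_sub_le_of_cubeIndex_eq hε,
    (h.klDiv_blockPlan_le hT hS').trans (ENNReal.ofReal_le_ofReal ?_)⟩
  have hpos : (0 : ℝ) < S.card := by
    obtain ⟨y, hy⟩ := hS'.exists
    exact_mod_cast Finset.card_pos.2 ⟨_, hy⟩
  refine (Real.log_le_log hpos hcard).trans_eq ?_
  rw [Real.log_pow, Real.log_div (by positivity) hε.ne', one_div, Real.log_inv]
  ring

/-- The suboptimality of an optimal entropic plan is at most `d ε log (1 / ε) + O(ε)`. -/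
theorem IsOptimalEntropicPlan.integral_inner_sub_le [IsProbabilityMeasure μ]
    [IsProbabilityMeasure ν] {γ : Measure (Space d × Space d)} {R ε : ℝ} (hR : 0 ≤ R)
    (hε : 0 < ε) (hε1 : ε ≤ 1) (hμ : ∀ᵐ x ∂μ, ‖x‖ ≤ R) (hν : ∀ᵐ y ∂ν, ‖y‖ ≤ R)
    (hγ : IsOptimalEntropicPlan ε μ ν γ) (h₀ : IsCoupling μ ν γ₀) :
    ∫ q, inner ℝ q.1 q.2 ∂γ₀ - ∫ q, inner ℝ q.1 q.2 ∂γ ≤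
      d * ε * Real.log (1 / ε) + (R * √d + d * Real.log (2 * R + 3)) * ε := by
  obtain ⟨γ', hγ', hcost, hkl⟩ := h₀.exists_low_entropy hR hε hε1 hμ hν
  have hlog : 0 ≤ Real.log (1 / ε) := Real.log_nonneg ((one_le_div hε).2 hε1)
  have hlog' : 0 ≤ Real.log (2 * R + 3) := Real.log_nonneg (by linarith)
  -- Nonnegativity ensures that `ENNReal.ofReal` truncates nothing when the cost inequality is read
  -- back in ℝ.
  have hnn : ∀ {σ : Measure (Space d × Space d)}, IsCoupling μ ν σ →
      0 ≤ 1 / 2 * ∫ x, ‖x‖ ^ 2 ∂μ + 1 / 2 * ∫ y, ‖y‖ ^ 2 ∂ν - ∫ q, inner ℝ q.1 q.2 ∂σ := by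
    intro σ hσ
    have := hσ.isProbabilityMeasure
    have hb := hσ.ae_norm_le hμ hν
    rw [← hσ.integral_fst (g := fun x => ‖x‖ ^ 2) (by fun_prop),
      ← hσ.integral_snd (g := fun x => ‖x‖ ^ 2) (by fun_prop), ← integral_const_mul,
      ← integral_const_mul, ← integral_add, ← integral_sub]
    · refine integral_nonneg fun q => ?_
      have := sq_nonneg ‖q.1 - q.2‖
      rw [norm_sub_sq_real] at this
      change 0 ≤ 1 / 2 * ‖q.1‖ ^ 2 + 1 / 2 * ‖q.2‖ ^ 2 - inner ℝ q.1 q.2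
      linarith
    all_goals exact integrable_of_ae_norm_le hb (by fun_prop)
  -- The entropy of γ itself is nonnegative and is dropped.
  have h1 : transportCost γ ≤ transportCost γ' + ENNReal.ofReal ε *
      ENNReal.ofReal (d * Real.log (1 / ε) + d * Real.log (2 * R + 3)) :=
    le_self_add.trans ((hγ.2 γ' hγ').trans (by unfold entropicCost; gcongr))
  have hd : (0 : ℝ) ≤ d := Nat.cast_nonneg d
  have hX : 0 ≤ ε * (d * Real.log (1 / ε) + d * Real.log (2 * R + 3)) := by positivity
  rw [hγ.1.transportCost_eq hμ hν, hγ'.transportCost_eq hμ hν, ← ENNReal.ofReal_mul hε.le,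
    ← ENNReal.ofReal_add (hnn hγ') hX, ENNReal.ofReal_le_ofReal_iff (add_nonneg (hnn hγ') hX)] at h1
  linarith

end EntropicOT

theorem mainTheorem10 (d : ℕ) (μ ν : Measure (EntropicOT.Space d))
    [IsProbabilityMeasure μ] [IsProbabilityMeasure ν]
    (hμ : IsCompact μ.support) (hν : IsCompact ν.support) :
    ∃ C : ℝ, ∀ f : EntropicOT.Space d → EReal, EntropicOT.IsBrenierPotential μ ν f →
      (∀ z, ∃! p, p ∈ EntropicOT.subdiffResolventSet f z) ∧
      ∀ ε : ℝ, 0 < ε → ε < 1 → ∀ γ : Measure (EntropicOT.Space d × EntropicOT.Space d),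
        EntropicOT.IsOptimalEntropicPlan ε μ ν γ →
          Integrable (fun q => ‖q.1 - EntropicOT.subdiffResolvent f (q.1 + q.2)‖ ^ 2) γ ∧
          ∫ q, ‖q.1 - EntropicOT.subdiffResolvent f (q.1 + q.2)‖ ^ 2 ∂γ
            ≤ (d : ℝ) * ε * Real.log (1 / ε) + C * ε := by
  obtain ⟨R, hR, hsub⟩ := (hμ.union hν).isBounded.exists_pos_norm_le
  have hμR : ∀ᵐ x ∂μ, ‖x‖ ≤ R := by
    filter_upwards [Measure.support_mem_ae (μ := μ)] with x hx using hsub x (Or.inl hx)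
  have hνR : ∀ᵐ y ∂ν, ‖y‖ ≤ R := by
    filter_upwards [Measure.support_mem_ae (μ := ν)] with y hy using hsub y (Or.inr hy)
  -- R and γ₀ are fixed before f, so the constant depends only on d and the marginals.
  obtain ⟨γ₀, hγ₀⟩ := EntropicOT.exists_isOptimalPlan hμR hνR
  refine ⟨R * √d + d * Real.log (2 * R + 3), fun f hf =>
    ⟨hf.properLscConvex.existsUnique_mem_subdiffResolventSet, fun ε hε hε1 γ hγ => ?_⟩⟩
  obtain ⟨hint, hle⟩ := EntropicOT.integral_norm_sub_subdiffResolvent_sq_le hf.properLscConvex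
    hμR hνR hγ₀.1 ((hf.optimal_iff γ₀ hγ₀.1).1 hγ₀) hγ.1
  exact ⟨hint, hle.trans (hγ.integral_inner_sub_le hR.le hε hε1.le hμR hνR hγ₀.1)⟩
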